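/- **Theorem 2.5.** Let $X$ be a finite non-empty set and let $r\colon X\times X\to X\times X$, $r(x,y)=(\sigma_x(y),\tau_y(x))$, be a bijective map with $$(r\times\mathrm{id})(\mathrm{id}\times r)(r\times\mathrm{id})=(\mathrm{id}\times r)(r\times\mathrm{id})(\mathrm{id}\times r),\qquad r^2=\mathrm{id},$$ such that all maps $\sigma_x,\tau_x\colon X\to X$ $(x\in X)$ are bijective; that is, let $(X,r)$ be a finite non-degenerate involutive set-theoretic solution to the Yang–Baxter equation. Let $\mathcal G(X,r)$ be its permutation group, i.e. the subgroup of $\operatorname{Sym}(X)$ generated by $\{\sigma_x : x\in X\}$. If every Sylow subgroup of $\mathcal G(X,r)$ is cyclic, then $(X,r)$ is a multipermutation solution: there is $n\ge 1$ such that $\operatorname{Ret}^n(X,r)$ has exactly one element. Here $\operatorname{Ret}(X,r)$ denotes the involutive solution induced by $r$ on $X/{\sim}$, where $x\sim y$ if and only if $\sigma_x=\sigma_y$, and $\operatorname{Ret}^1=\operatorname{Ret}$, $\operatorname{Ret}^{n+1}(X,r)=\operatorname{Ret}(\operatorname{Ret}^n(X,r))$ for $n\geq 1$. -/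

import Mathlib

namespace YangBaxter

universe u

/-- The map `r × id` on triples. -/
def r12 {X : Type u} (r : X × X → X × X) (t : X × X × X) : X × X × X :=
  ((r (t.1, t.2.1)).1, (r (t.1, t.2.1)).2, t.2.2)

/-- The map `id × r` on triples. -/
def r23 {X : Type u} (r : X × X → X × X) (t : X × X × X) : X × X × X :=
  (t.1, r t.2)

/-- A (non-degenerate, set-theoretic) solution `(X, r)` to the Yang--Baxter equation,
with `r (x, y) = (σ_x y, τ_y x)`. -/
structure Solution (X : Type u) where
  /-- The underlying map. -/
  r : X × X → X × X
  bijective_r : Function.Bijective r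
  yang_baxter : r12 r ∘ r23 r ∘ r12 r = r23 r ∘ r12 r ∘ r23 r
  bijective_left : ∀ x : X, Function.Bijective (fun y => (r (x, y)).1)
  bijective_right : ∀ y : X, Function.Bijective (fun x => (r (x, y)).2)

/-- An involutive solution: a solution with `r ∘ r = id`. -/
structure InvolutiveSolution (X : Type u) extends Solution X where
  involutive_r : r ∘ r = id

/-- The permutation `σ_x` of `X`. -/
noncomputable def Solution.sigma {X : Type u} (S : Solution X) (x : X) : Equiv.Perm X :=
  Equiv.ofBijective (fun y => (S.r (x, y)).1) (S.bijective_left x)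

/-- The permutation `τ_y` of `X`. -/
noncomputable def Solution.tau {X : Type u} (S : Solution X) (y : X) : Equiv.Perm X :=
  Equiv.ofBijective (fun x => (S.r (x, y)).2) (S.bijective_right y)

theorem Solution.r_eq {X : Type u} (S : Solution X) (x y : X) :
    S.r (x, y) = (S.sigma x y, S.tau y x) := rfl

theorem Solution.sigma_braid {X : Type u} (S : Solution X) (x y z : X) :
    S.sigma (S.sigma x y) (S.sigma (S.tau y x) z) = S.sigma x (S.sigma y z) :=
  congrArg (fun t => t.1) (congrFun S.yang_baxter (x, y, z))

theorem Solution.tau_braid {X : Type u} (S : Solution X) (x y z : X) :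
    S.tau z (S.tau y x) = S.tau (S.tau z y) (S.tau (S.sigma y z) x) :=
  congrArg (fun t => t.2.2) (congrFun S.yang_baxter (x, y, z))

namespace InvolutiveSolution

variable {X : Type u} (S : InvolutiveSolution X)

/-- The permutation group `𝒢(X, r)`: the subgroup of `Sym(X)` generated by all `σ_x`. -/
noncomputable def permutationGroup : Subgroup (Equiv.Perm X) :=
  Subgroup.closure (Set.range S.sigma)

/-- The relation `x ∼ y` if and only if `σ_x = σ_y`. -/
def retractSetoid : Setoid X where
  r x y := S.sigma x = S.sigma y
  iseqv := ⟨fun _ => rfl, fun h => h.symm, fun h k => h.trans k⟩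

theorem r_r (p : X × X) : S.r (S.r p) = p := congrFun S.involutive_r p

theorem sigma_sigma_tau (x y : X) : S.sigma (S.sigma x y) (S.tau y x) = x :=
  congrArg Prod.fst (S.r_r (x, y))

theorem tau_tau_sigma (x y : X) : S.tau (S.tau y x) (S.sigma x y) = y :=
  congrArg Prod.snd (S.r_r (x, y))

theorem fix_iff (u z : X) : S.sigma u z = u ↔ S.tau z u = z := by
  constructor
  · intro h
    have h1 := S.sigma_sigma_tau u z
    rw [h] at h1
    exact (S.sigma u).injective (h1.trans h.symm)
  · intro h
    have h1 := S.tau_tau_sigma u z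
    rw [h] at h1
    exact (S.tau z).injective (h1.trans h.symm)

theorem fix_sigma (u v z : X) (h : S.sigma (S.tau v u) z = S.tau v u) :
    S.sigma u (S.sigma v z) = u := by
  rw [← S.sigma_braid, h, S.sigma_sigma_tau]

theorem sigma_eq_iff_tau_eq (v v' : X) : S.sigma v = S.sigma v' ↔ S.tau v = S.tau v' := by
  constructor
  · intro h
    ext u
    obtain ⟨z, hz⟩ := (S.sigma (S.tau v u)).surjective (S.tau v u)
    have h1 := (S.fix_iff _ _).1 (S.fix_sigma u v z hz)
    obtain ⟨u', hu'⟩ := (S.tau v').surjective (S.tau v u)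
    have h2 : S.sigma (S.tau v' u') z = S.tau v' u' := by rw [hu']; exact hz
    have h3 := (S.fix_iff _ _).1 (S.fix_sigma u' v' z h2)
    rw [← h] at h3
    have h4 : u = u' := (S.tau (S.sigma v z)).injective (h1.trans h3.symm)
    rw [h4, hu', ← h4]
  · intro h
    ext z
    obtain ⟨y, hy⟩ := (S.tau z).surjective z
    have hy' := (S.fix_iff _ _).2 hy
    obtain ⟨u, hu⟩ := (S.tau v).surjective y
    have h1 : S.sigma u (S.sigma v z) = u := S.fix_sigma u v z (by rw [hu]; exact hy')
    have h2 : S.sigma u (S.sigma v' z) = u := S.fix_sigma u v' z (by rw [← h, hu]; exact hy')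
    exact (S.sigma u).injective (h1.trans h2.symm)

theorem rel_of_sigma_rel (x y y' : X)
    (h : S.sigma (S.sigma x y) = S.sigma (S.sigma x y')) : S.sigma y = S.sigma y' := by
  have h1 : S.tau y x = S.tau y' x := by
    apply (S.sigma (S.sigma x y)).injective
    rw [S.sigma_sigma_tau, h, S.sigma_sigma_tau]
  ext z
  apply (S.sigma x).injective
  rw [← S.sigma_braid x y z, ← S.sigma_braid x y' z, h, h1]

theorem rel_of_tau_rel (z y y' : X)
    (h : S.sigma (S.tau z y) = S.sigma (S.tau z y')) : S.sigma y = S.sigma y' := by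
  rw [sigma_eq_iff_tau_eq] at h ⊢
  have h1 : S.sigma y z = S.sigma y' z := by
    apply (S.tau (S.tau z y)).injective
    rw [S.tau_tau_sigma, h, S.tau_tau_sigma]
  ext x
  apply (S.tau z).injective
  rw [S.tau_braid x y z, S.tau_braid x y' z, h, h1]

theorem sigma_rel (x x' y y' : X) (hx : S.sigma x = S.sigma x') (hy : S.sigma y = S.sigma y') :
    S.sigma (S.sigma x y) = S.sigma (S.sigma x' y') := by
  rw [← hx]
  apply S.rel_of_tau_rel (S.tau y x)
  rw [S.tau_tau_sigma, (S.sigma_eq_iff_tau_eq y y').1 hy, S.tau_tau_sigma]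
  exact hy

theorem tau_rel (x x' y y' : X) (hx : S.sigma x = S.sigma x') (hy : S.sigma y = S.sigma y') :
    S.sigma (S.tau y x) = S.sigma (S.tau y' x') := by
  rw [← (S.sigma_eq_iff_tau_eq y y').1 hy]
  apply S.rel_of_sigma_rel (S.sigma x y)
  rw [S.sigma_sigma_tau, hx, S.sigma_sigma_tau]

/-- The map induced by `r` on `X/∼`, namely `([x], [y]) ↦ ([σ_x y], [τ_y x])`. -/
noncomputable def retractMap (p : Quotient S.retractSetoid × Quotient S.retractSetoid) :
    Quotient S.retractSetoid × Quotient S.retractSetoid :=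
  (Quotient.map₂ (fun x y => S.sigma x y)
      (fun x x' hx y y' hy => S.sigma_rel x x' y y' hx hy) p.1 p.2,
   Quotient.map₂ (fun x y => S.tau y x)
      (fun x x' hx y y' hy => S.tau_rel x x' y y' hx hy) p.1 p.2)

theorem retractMap_mk (x y : X) :
    S.retractMap (Quotient.mk _ x, Quotient.mk _ y) =
      (Quotient.mk _ (S.r (x, y)).1, Quotient.mk _ (S.r (x, y)).2) := rfl

theorem retractMap_involutive : S.retractMap ∘ S.retractMap = id := by
  funext ⟨a, b⟩
  induction a using Quotient.inductionOn
  induction b using Quotient.inductionOn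
  simp only [Function.comp_apply, retractMap_mk, Prod.mk.eta, r_r, id]

/-- The retraction `Ret(X, r)`: the involutive solution induced by `(X, r)` on `X/∼`. -/
noncomputable def ret : InvolutiveSolution (Quotient S.retractSetoid) where
  r := S.retractMap
  bijective_r := Function.Involutive.bijective (congrFun S.retractMap_involutive)
  yang_baxter := by
    funext ⟨a, b, c⟩
    induction a using Quotient.inductionOn with | h x => ?_
    induction b using Quotient.inductionOn with | h y => ?_
    induction c using Quotient.inductionOn with | h z => ?_
    exact congrArg (fun t : X × X × X => ((Quotient.mk S.retractSetoid t.1,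
      Quotient.mk S.retractSetoid t.2.1, Quotient.mk S.retractSetoid t.2.2)))
      (congrFun S.yang_baxter (x, y, z))
  bijective_left := by
    intro a
    induction a using Quotient.inductionOn with | h x => ?_
    constructor
    · intro b c h
      induction b using Quotient.inductionOn with | h y => ?_
      induction c using Quotient.inductionOn with | h z => ?_
      exact Quotient.sound (S.rel_of_sigma_rel x y z (Quotient.exact h))
    · intro b
      induction b using Quotient.inductionOn with | h y => ?_
      obtain ⟨z, hz⟩ := (S.sigma x).surjective y
      exact ⟨Quotient.mk _ z, congrArg (Quotient.mk S.retractSetoid) hz⟩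
  bijective_right := by
    intro a
    induction a using Quotient.inductionOn with | h x => ?_
    constructor
    · intro b c h
      induction b using Quotient.inductionOn with | h y => ?_
      induction c using Quotient.inductionOn with | h z => ?_
      exact Quotient.sound (S.rel_of_tau_rel x y z (Quotient.exact h))
    · intro b
      induction b using Quotient.inductionOn with | h y => ?_
      obtain ⟨z, hz⟩ := (S.tau x).surjective y
      exact ⟨Quotient.mk _ z, congrArg (Quotient.mk S.retractSetoid) hz⟩
  involutive_r := S.retractMap_involutive

/-- The iterated retraction `Ret^n(X, r)`, as a set together with an involutive solution on it;
`Ret^0(X, r) = (X, r)` and `Ret^(n+1)(X, r) = Ret(Ret^n(X, r))`. -/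
noncomputable def retIter : ℕ → Σ Y : Type u, InvolutiveSolution Y
  | 0 => ⟨X, S⟩
  | n + 1 => ⟨Quotient (retIter n).2.retractSetoid, (retIter n).2.ret⟩

/-- `(X, r)` is a multipermutation solution if, for some `n ≥ 1`, the set underlying
`Ret^n(X, r)` has exactly one element. -/
def IsMultipermutation : Prop :=
  ∃ n : ℕ, 1 ≤ n ∧ Nat.card (S.retIter n).1 = 1

end InvolutiveSolution

end YangBaxter

/-!
The map `x ↦ σ_x` extends to a map `φ` from the free commutative monoid on `X` onto the permutation
group `G` with `φ (a + φ(a) b) = φ(a) φ(b)` (`permOf_mul`). The relation `φ a = φ b` is an additive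
congruence, and its quotient `A` is a finite abelian group on which `G` acts, together with a
bijective `1`-cocycle `G → A` (`cocycle_mul`). This is the brace structure on the permutation group.

Let the Sylow subgroups of `G ≠ 1` be cyclic. The commutator subgroup is then a cyclic Hall
subgroup, so some nontrivial Sylow subgroup `P` is normal, say for the prime `p`. The cocycle maps
`P` onto the `p`-primary part of `A`. Normality of `P` and invariance of the primary parts force `P`
to act trivially on the part of `A` of order prime to `p`. On the `p`-primary part, which has `|P|`
elements and contains the fixed point `0`, no orbit of `P` has length `|P|`, so the subgroup of
order `p` of the cyclic group `P` acts trivially there too. Hence some `g ≠ 1` acts trivially on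
`A` (`exists_ne_one_smul_eq`), which means `σ_{g x} = σ_x` for all `x`, so `σ` is not injective.

Consequently the retraction of such a solution with more than one point has fewer points. Its
permutation group is a section of `G`, so its Sylow subgroups are again cyclic, and induction on the
number of points finishes the proof.
-/

namespace YangBaxter

universe u

/-! ### Normal Sylow subgroups -/

/-- A Sylow `p`-subgroup of a normal abelian subgroup of index prime to `p` is characteristic there,
hence normal in the whole group, and it is a Sylow subgroup of the whole group. -/
theorem exists_normal_sylow_of_coprime_index {G : Type*} [Group G] [Finite G] (N : Subgroup G)
    [N.Normal] [IsMulCommutative N] {p : ℕ} [Fact p.Prime] (hp : ¬ p ∣ N.index) :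
    ∃ P : Sylow p G, (P : Subgroup G).Normal := by
  obtain ⟨Q⟩ : Nonempty (Sylow p N) := inferInstance
  have hQn : (Q : Subgroup N).Normal :=
    ⟨fun n hn g => by rwa [mul_comm' g n, mul_inv_cancel_right]⟩
  have := Q.characteristic_of_normal hQn
  have hidx : ¬ p ∣ ((Q : Subgroup N).map N.subtype).index := by
    rw [Subgroup.index_map_subtype]
    exact (Fact.out : p.Prime).not_dvd_mul Q.not_dvd_index hp
  refine ⟨(Q.isPGroup'.map N.subtype).toSylow hidx, ?_⟩
  rw [IsPGroup.toSylow_coe]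
  infer_instance

/-- A nontrivial finite group with cyclic Sylow subgroups has a nontrivial normal Sylow subgroup:
its commutator subgroup is a cyclic Hall subgroup. -/
theorem exists_normal_sylow (G : Type*) [Group G] [Finite G] [IsZGroup G] [Nontrivial G] :
    ∃ (p : ℕ) (_ : p.Prime) (P : Sylow p G), p ∣ Nat.card G ∧ (P : Subgroup G).Normal := by
  by_cases h : commutator G = ⊥
  · have hp : (Nat.card G).minFac.Prime := Nat.minFac_prime Finite.one_lt_card.ne'
    have := Fact.mk hp
    have : IsMulCommutative (⊤ : Subgroup G) := by
      rwa [← Subgroup.le_centralizer_iff_isMulCommutative,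
        ← Subgroup.commutator_eq_bot_iff_le_centralizer, ← commutator_def]
    obtain ⟨P, hP⟩ := exists_normal_sylow_of_coprime_index (⊤ : Subgroup G)
      (p := (Nat.card G).minFac) (by rw [Subgroup.index_top]; exact hp.not_dvd_one)
    exact ⟨_, hp, P, Nat.minFac_dvd _, hP⟩
  · have h1 : Nat.card (commutator G) ≠ 1 := fun h1 => h (Subgroup.card_eq_one.1 h1)
    have hp := Nat.minFac_prime h1
    have := Fact.mk hp
    have := IsZGroup.isCyclic_commutator G
    have hdvd := Nat.minFac_dvd (Nat.card (commutator G))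
    obtain ⟨P, hP⟩ := exists_normal_sylow_of_coprime_index (commutator G)
      (p := (Nat.card (commutator G)).minFac) fun h2 =>
        Nat.not_coprime_of_dvd_of_dvd hp.one_lt hdvd h2 (IsZGroup.coprime_commutator_index G)
    exact ⟨_, hp, P, hdvd.trans (Subgroup.card_subgroup_dvd_card _), hP⟩

/-! ### Non-faithfulness of actions with a bijective cocycle -/

/-- If `p ^ k` is the exact power of `p` in the order of `A`, then the `p`-primary part of `A`, the
kernel of multiplication by `p ^ k`, has order `p ^ k`. -/
theorem card_ker_nsmul_pow {A : Type*} [AddCommGroup A] [Finite A] {p k m : ℕ} (hp : p.Prime)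
    (hA : Nat.card A = p ^ k * m) (hm : ¬ p ∣ m) :
    Nat.card (nsmulAddMonoidHom (α := A) (p ^ k)).ker = p ^ k := by
  have := Fact.mk hp
  set f := nsmulAddMonoidHom (α := A) (p ^ k)
  have hmul : Nat.card f.ker * Nat.card f.range = p ^ k * m := by
    rw [← AddSubgroup.index_ker, AddSubgroup.card_mul_index, hA]
  obtain ⟨j, hj⟩ : ∃ j, Nat.card f.ker = p ^ j := by
    apply (IsPGroup.iff_card (G := Multiplicative f.ker)).1
    intro a
    refine ⟨k, ?_⟩
    apply Multiplicative.toAdd.injective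
    exact Subtype.ext (Multiplicative.toAdd a).2
  have hr : ¬ p ∣ Nat.card f.range := by
    intro h
    obtain ⟨⟨b, a, rfl⟩, hb⟩ := exists_prime_addOrderOf_dvd_card' p h
    have h1 : m • f a = 0 := by
      change m • (p ^ k • a) = 0
      rw [← mul_nsmul, ← hA]
      exact card_nsmul_eq_zero'
    apply hm
    rw [← hb]
    exact addOrderOf_dvd_of_nsmul_eq_zero (Subtype.ext h1)
  rw [hj] at hmul ⊢
  have h1 : (p ^ j).Coprime m := Nat.Coprime.pow_left _ ((Nat.Prime.coprime_iff_not_dvd hp).2 hm)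
  have h2 : (p ^ k).Coprime (Nat.card f.range) :=
    Nat.Coprime.pow_left _ ((Nat.Prime.coprime_iff_not_dvd hp).2 hr)
  exact Nat.dvd_antisymm (h1.dvd_of_dvd_mul_right (hmul ▸ dvd_mul_right _ _))
    (h2.dvd_of_dvd_mul_right (hmul ▸ dvd_mul_right _ _))

/-- A group of order `p ^ (k + 1)` acting on at most `p ^ (k + 1)` points, one of them
fixed, has no orbit of length `p ^ (k + 1)`, so `p ^ k`-th powers act trivially. -/
theorem pow_smul_eq_of_fixed {P T : Type*} [CommGroup P] [MulAction P T] [Finite T] {p k : ℕ}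
    (hp : p.Prime) (hP : Nat.card P = p ^ (k + 1)) (hT : Nat.card T ≤ p ^ (k + 1)) {t₀ : T}
    (h₀ : ∀ g : P, g • t₀ = t₀) (g : P) (t : T) : g ^ p ^ k • t = t := by
  by_cases ht : t = t₀
  · rw [ht, h₀]
  have hlt : (MulAction.stabilizer P t).index < p ^ (k + 1) := by
    rw [MulAction.index_stabilizer]
    refine lt_of_lt_of_le ?_ hT
    rw [← Set.ncard_univ]
    refine Set.ncard_lt_ncard ((Set.ssubset_univ_iff).2 fun h => ?_) (Set.toFinite _)
    obtain ⟨x, hx⟩ := MulAction.mem_orbit_iff.1 (h ▸ Set.mem_univ t₀ : t₀ ∈ MulAction.orbit P t)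
    apply ht
    rw [← inv_smul_smul x t, hx, h₀]
  obtain ⟨i, hi, hi'⟩ := (Nat.dvd_prime_pow hp).1
    (hP ▸ (MulAction.stabilizer P t).index_dvd_card)
  rw [hi'] at hlt
  have hik : i ≤ k := Nat.lt_succ_iff.1 ((Nat.pow_lt_pow_iff_right hp.one_lt).1 hlt)
  obtain ⟨d, hd⟩ := pow_dvd_pow p hik
  rw [hd, pow_mul, ← hi']
  exact (MulAction.stabilizer P t).pow_mem ((MulAction.stabilizer P t).pow_index_mem g) d

/-- If a nontrivial finite group `G` with cyclic Sylow subgroups acts on an abelian group `A` and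
admits a bijective `1`-cocycle to `A`, then the action is not faithful. In terms of braces: a
nontrivial finite brace whose multiplicative group has cyclic Sylow subgroups has nontrivial
socle. -/
theorem exists_ne_one_smul_eq {G A : Type*} [Group G] [Finite G] [IsZGroup G] [Nontrivial G]
    [AddCommGroup A] [DistribMulAction G A] (c : G ≃ A)
    (hc : ∀ g h, c (g * h) = c g + g • c h) : ∃ g : G, g ≠ 1 ∧ ∀ a : A, g • a = a := by
  obtain ⟨p, hp, P, hpG, hPn⟩ := exists_normal_sylow G
  have := Fact.mk hp
  have : Finite A := Finite.of_equiv G c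
  have hc1 : c 1 = 0 := by simpa using hc 1 1
  obtain ⟨n, m, hm, hGm⟩ := Nat.exists_eq_pow_mul_and_not_dvd Nat.card_pos.ne' p hp.ne_one
    (n := Nat.card G)
  have hAm : Nat.card A = p ^ n * m := by rw [← Nat.card_congr c, hGm]
  obtain ⟨k, rfl⟩ : ∃ k, n = k + 1 := by
    refine Nat.exists_eq_succ_of_ne_zero ?_
    rintro rfl
    rw [hGm, pow_zero, one_mul] at hpG
    exact hm hpG
  have hPcard : Nat.card P = p ^ (k + 1) := by
    rw [P.card_eq_multiplicity, hGm, Nat.factorization_mul (pow_ne_zero _ hp.ne_zero)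
      (by rintro rfl; exact hm (dvd_zero p))]
    simp [Nat.factorization_eq_zero_of_not_dvd hm, hp.factorization_self]
  have hcop : IsCoprime ((p ^ (k + 1) : ℕ) : ℤ) (m : ℤ) :=
    Nat.isCoprime_iff_coprime.2 (Nat.Coprime.pow_left _ ((Nat.Prime.coprime_iff_not_dvd hp).2 hm))
  obtain ⟨u, v, huv⟩ := hcop
  -- The `p`-primary part of `A` corresponds to a subgroup of `G`, which can only be `P`.
  let H : Subgroup G :=
    { carrier := {g | p ^ (k + 1) • c g = 0}
      mul_mem' := fun {a b} ha hb => by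
        simp only [Set.mem_ofPred_eq] at ha hb ⊢
        rw [hc, nsmul_add, ha, smul_comm, hb, smul_zero, add_zero]
      one_mem' := by simp [hc1]
      inv_mem' := fun {a} ha => by
        simp only [Set.mem_ofPred_eq] at ha ⊢
        have h := hc a⁻¹ a
        rw [inv_mul_cancel, hc1] at h
        rw [eq_neg_of_add_eq_zero_left h.symm, smul_neg, smul_comm, ha, smul_zero,
          neg_zero] }
  have hHcard : Nat.card H = p ^ (k + 1) := by
    rw [← card_ker_nsmul_pow hp hAm hm]
    exact Nat.card_congr (c.subtypeEquiv fun g => Iff.rfl)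
  have hHP : H = P := by
    obtain ⟨Q, hQ⟩ := (IsPGroup.of_card hHcard).exists_le_sylow
    have := Sylow.unique_of_normal P hPn
    rw [Subsingleton.elim Q P] at hQ
    exact Subgroup.eq_of_le_of_card_ge hQ (by rw [hHcard]; exact hPcard.le)
  have hmemP (g : G) : g ∈ (P : Subgroup G) ↔ p ^ (k + 1) • c g = 0 := by
    rw [← hHP]
    rfl
  -- If `c g` is killed by `m` and `h * g = g * z` with `h`, `z` in `P`, then
  -- `h • c g - c g = g • c z - c h` lies in both primary parts, hence vanishes.
  have hfix_compl (h : G) (hh : h ∈ (P : Subgroup G)) (a : A) (ha : m • a = 0) : h • a = a := by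
    obtain ⟨g, rfl⟩ := c.surjective a
    have hz : g⁻¹ * h * g ∈ (P : Subgroup G) := by
      simpa using hPn.conj_mem h hh g⁻¹
    have key : h • c g - c g = g • c (g⁻¹ * h * g) - c h := by
      rw [sub_eq_sub_iff_add_eq_add, add_comm, ← hc, add_comm, ← hc]
      congr 1
      group
    have h1 : (m : ℤ) • (h • c g - c g) = 0 := by
      rw [natCast_zsmul, smul_sub, smul_comm, ha, smul_zero, sub_zero]
    have h2 : ((p ^ (k + 1) : ℕ) : ℤ) • (h • c g - c g) = 0 := by
      rw [key, natCast_zsmul, smul_sub, smul_comm, (hmemP _).1 hz, (hmemP _).1 hh, smul_zero,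
        sub_zero]
    rw [← sub_eq_zero, ← one_zsmul (h • c g - c g), ← huv, add_zsmul, mul_zsmul, mul_zsmul, h1, h2,
      smul_zero, smul_zero, add_zero]
  -- The `p`-primary part of `A`, with the action of `P`.
  let AP : SubMulAction P A :=
    { carrier := {a | p ^ (k + 1) • a = 0}
      smul_mem' := fun g a ha => by
        change p ^ (k + 1) • ((g : G) • a) = 0
        rw [smul_comm, show p ^ (k + 1) • a = 0 from ha, smul_zero] }
  have hAP : Nat.card AP ≤ p ^ (k + 1) := (card_ker_nsmul_pow hp hAm hm).le
  have hPcyc : IsCyclic P := inferInstance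
  obtain ⟨g, hg⟩ := hPcyc.exists_generator
  let _ : CommGroup P := IsCyclic.commGroup
  have hfix_ker (a : A) (ha : p ^ (k + 1) • a = 0) : (g ^ p ^ k : P) • a = a :=
    congrArg Subtype.val <| pow_smul_eq_of_fixed (T := AP) hp hPcard hAP (t₀ := ⟨0, smul_zero _⟩)
      (fun x => Subtype.ext (smul_zero x)) g ⟨a, ha⟩
  -- The subgroup of order `p` in `P` acts trivially on both primary parts, hence on `A`.
  refine ⟨(g ^ p ^ k : P), fun h1 => ?_, fun a => ?_⟩
  · have h2 : orderOf g ∣ p ^ k := orderOf_dvd_of_pow_eq_one (Subtype.ext h1)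
    rw [orderOf_eq_card_of_forall_mem_zpowers hg, hPcard] at h2
    exact absurd ((Nat.pow_dvd_pow_iff_le_right hp.one_lt).1 h2) (Nat.not_succ_le_self k)
  · have hcard : (p ^ (k + 1) * m) • a = 0 := by
      rw [← hAm]
      exact card_nsmul_eq_zero'
    have ha : a = v • m • a + u • p ^ (k + 1) • a := by
      conv_lhs => rw [← one_zsmul a, ← huv, add_zsmul, mul_zsmul, mul_zsmul, natCast_zsmul,
        natCast_zsmul, add_comm]
    have h1 : (g ^ p ^ k : P) • m • a = m • a := hfix_ker _ (by rw [← mul_nsmul', hcard])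
    have h2 : ((g ^ p ^ k : P) : G) • p ^ (k + 1) • a = p ^ (k + 1) • a :=
      hfix_compl _ (g ^ p ^ k : P).2 _ (by rw [← mul_nsmul, hcard])
    rw [Subgroup.smul_def] at h1
    conv_lhs => rw [ha, smul_add, smul_comm _ v, h1, smul_comm _ u, h2, ← ha]

/-! ### The permutation brace -/

namespace InvolutiveSolution

variable {X : Type u} (S : InvolutiveSolution X)

theorem sigma_mul_sigma (x y : X) :
    S.sigma x * S.sigma y = S.sigma (S.sigma x y) * S.sigma (S.tau y x) :=
  Equiv.ext fun z => (S.sigma_braid x y z).symm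

/-- The cycle set identity: `σ_v σ_{σ_v⁻¹ u}` is symmetric in `u` and `v`. -/
theorem sigma_mul_sigma_inv (u v : X) :
    S.sigma v * S.sigma ((S.sigma v)⁻¹ u) = S.sigma u * S.sigma ((S.sigma u)⁻¹ v) := by
  have h := S.sigma_mul_sigma v ((S.sigma v)⁻¹ u)
  have h1 := S.sigma_sigma_tau v ((S.sigma v)⁻¹ u)
  rw [show S.sigma v ((S.sigma v)⁻¹ u) = u from (S.sigma v).apply_symm_apply u] at h h1
  rw [h]
  congr 2
  rw [Equiv.Perm.eq_inv_iff_eq, h1]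

/-- The value of `permOf` on `x ::ₘ a`, in terms of `x` and `g = permOf a`. -/
noncomputable def extend (x : X) (g : Equiv.Perm X) : Equiv.Perm X :=
  g * S.sigma (g⁻¹ x)

instance : LeftCommutative S.extend where
  left_comm x y g := by
    have h := S.sigma_mul_sigma_inv (g⁻¹ x) (g⁻¹ y)
    simp only [extend, mul_assoc, mul_inv_rev, Equiv.Perm.mul_apply, h]

/-- The extension of `x ↦ σ_x` to a map `φ` from the free commutative monoid on `X` to `Sym(X)`
with `φ (a + φ(a) b) = φ(a) φ(b)`. -/
noncomputable def permOf (a : Multiset X) : Equiv.Perm X :=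
  a.foldr S.extend 1

theorem permOf_singleton (x : X) : S.permOf {x} = S.sigma x := by
  simp [permOf, extend]

/-- Folding from `g` instead of `1` amounts to translating by `g`; this gives the cocycle identity
`permOf_mul`. -/
theorem foldr_extend (g : Equiv.Perm X) (a : Multiset X) :
    a.foldr S.extend g = g * S.permOf (a.map ⇑g⁻¹) := by
  induction a using Multiset.induction_on with
  | empty => exact (mul_one g).symm
  | cons x a ih =>
    rw [Multiset.foldr_cons, ih, Multiset.map_cons, permOf, permOf, Multiset.foldr_cons, extend,
      extend, mul_inv_rev, Equiv.Perm.mul_apply, mul_assoc]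

theorem permOf_add (a b : Multiset X) :
    S.permOf (a + b) = S.permOf a * S.permOf (b.map ⇑(S.permOf a)⁻¹) := by
  rw [add_comm, permOf, Multiset.foldr_add, foldr_extend]
  rfl

theorem permOf_mul (a b : Multiset X) :
    S.permOf a * S.permOf b = S.permOf (a + b.map ⇑(S.permOf a)) := by
  rw [permOf_add, Multiset.map_map]
  simp

theorem sigma_mem (x : X) : S.sigma x ∈ S.permutationGroup :=
  Subgroup.subset_closure ⟨x, rfl⟩

theorem permOf_mem (a : Multiset X) : S.permOf a ∈ S.permutationGroup := by
  induction a using Multiset.induction_on with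
  | empty => exact one_mem _
  | cons x a ih =>
    rw [permOf, Multiset.foldr_cons, ← permOf, extend]
    exact mul_mem ih (S.sigma_mem _)

theorem exists_permOf_eq [Finite X] {g : Equiv.Perm X} (hg : g ∈ S.permutationGroup) :
    ∃ a, S.permOf a = g := by
  rw [permutationGroup, ← Subgroup.mem_toSubmonoid, Subgroup.closure_toSubmonoid_of_finite] at hg
  induction hg using Submonoid.closure_induction with
  | mem g hg =>
    obtain ⟨x, rfl⟩ := hg
    exact ⟨{x}, S.permOf_singleton x⟩
  | one => exact ⟨0, rfl⟩
  | mul g h _ _ hg hh =>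
    obtain ⟨a, rfl⟩ := hg
    obtain ⟨b, rfl⟩ := hh
    exact ⟨_, (S.permOf_mul a b).symm⟩

/-- The congruence `φ a = φ b`. It is compatible with addition because `φ (a + c)` is determined by
`φ a` and `c`. -/
noncomputable def permCon : AddCon (Multiset X) :=
  { Setoid.ker S.permOf with
    add' := by
      have h (a b c : Multiset X) (hab : S.permOf a = S.permOf b) :
          S.permOf (a + c) = S.permOf (b + c) := by
        rw [permOf_add, permOf_add, hab]
      intro a b c d hab hcd
      exact (h a b c hab).trans (by rw [add_comm b, add_comm b]; exact h c d b hcd) }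

theorem coe_eq_iff {a b : Multiset X} :
    (a : S.permCon.Quotient) = b ↔ S.permOf a = S.permOf b :=
  S.permCon.eq

/-! ### The retraction -/

theorem rel_map_iff {g : Equiv.Perm X} (hg : g ∈ S.permutationGroup) (x y : X) :
    S.sigma x = S.sigma y ↔ S.sigma (g x) = S.sigma (g y) := by
  induction hg using Subgroup.closure_induction generalizing x y with
  | mem g hg =>
    obtain ⟨z, rfl⟩ := hg
    exact ⟨fun h => S.sigma_rel z z x y rfl h, S.rel_of_sigma_rel z x y⟩
  | one => rfl
  | mul g h _ _ hg hh => exact (hh x y).trans (hg _ _)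
  | inv g _ hg => simpa using (hg (g⁻¹ x) (g⁻¹ y)).symm

/-- The action of the permutation group on the retraction. -/
def quotientHom : S.permutationGroup →* Equiv.Perm (Quotient S.retractSetoid) where
  toFun g := Quotient.congr g.1 (S.rel_map_iff g.2)
  map_one' := Equiv.ext fun a => Quotient.inductionOn a fun _ => rfl
  map_mul' _ _ := Equiv.ext fun a => Quotient.inductionOn a fun _ => rfl

/-- The permutation group of the retraction is a section of the permutation group. -/
theorem permutationGroup_ret_le : S.ret.permutationGroup ≤ S.quotientHom.range := by
  rw [permutationGroup, Subgroup.closure_le]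
  rintro _ ⟨a, rfl⟩
  induction a using Quotient.inductionOn with | h x => ?_
  exact ⟨⟨_, S.sigma_mem x⟩, Equiv.ext fun b => Quotient.inductionOn b fun _ => rfl⟩

theorem retIter_succ (n : ℕ) : S.retIter (n + 1) = S.ret.retIter n := by
  induction n with
  | zero => rfl
  | succ n ih => rw [retIter, ih, retIter]

/-! ### The cocycle of a finite solution -/

variable [Finite X]

theorem exists_permOf_add_eq_one (a : Multiset X) : ∃ b, S.permOf (b + a) = 1 := by
  obtain ⟨c, hc⟩ := S.exists_permOf_eq (inv_mem (S.permOf_mem a))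
  refine ⟨c.map ⇑(S.permOf a), ?_⟩
  rw [add_comm, ← permOf_mul, hc, mul_inv_cancel]

/-- Negation, with representatives picked by choice; negatives exist because every element of the
permutation group, in particular `(φ a)⁻¹`, is a value of `φ`. -/
noncomputable instance : Neg S.permCon.Quotient where
  neg a := ((S.exists_permOf_add_eq_one a.out).choose : Multiset X)

/-- The additive group of the permutation brace of `S`. -/
noncomputable instance : AddCommGroup S.permCon.Quotient :=
  { (inferInstance : AddCommMonoid S.permCon.Quotient) with
    zsmul := zsmulRec
    neg_add_cancel := fun a => by
      have h := (S.exists_permOf_add_eq_one a.out).choose_spec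
      conv_lhs => rhs; rw [← Quotient.out_eq a]
      exact (S.coe_eq_iff).2 h }

/-- The action of the permutation group on `X` respects `φ a = φ b`: addition of `d` turns it into
left multiplication by `φ d`, and addition is cancellative. -/
theorem permOf_map_congr {g : Equiv.Perm X} (hg : g ∈ S.permutationGroup) {a b : Multiset X}
    (h : S.permOf a = S.permOf b) : S.permOf (a.map g) = S.permOf (b.map g) := by
  obtain ⟨d, rfl⟩ := S.exists_permOf_eq hg
  rw [← coe_eq_iff]
  apply add_left_cancel (a := (d : S.permCon.Quotient))
  rw [← AddCon.coe_add, ← AddCon.coe_add, coe_eq_iff, ← permOf_mul, ← permOf_mul, h]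

/-- The action of the permutation group on the additive group of the permutation brace. -/
noncomputable instance : DistribMulAction S.permutationGroup S.permCon.Quotient where
  smul g := Quotient.map (Multiset.map g) fun _ _ h => S.permOf_map_congr g.2 h
  one_smul a := by
    induction a using AddCon.induction_on with | H a => ?_
    exact congrArg _ (Multiset.map_id a)
  mul_smul g h a := by
    induction a using AddCon.induction_on with | H a => ?_
    exact congrArg _ (Multiset.map_map g.1 h.1 a).symm
  smul_zero g := rfl
  smul_add g a b := by
    induction a using AddCon.induction_on with | H a => ?_
    induction b using AddCon.induction_on with | H b => ?_
    exact congrArg _ (Multiset.map_add g.1 a b)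

theorem smul_coe (g : S.permutationGroup) (a : Multiset X) :
    g • (a : S.permCon.Quotient) = (a.map g.1 : Multiset X) := rfl

/-- The bijection between the permutation group and the additive group of its brace. -/
noncomputable def cocycle : S.permutationGroup ≃ S.permCon.Quotient :=
  (Equiv.ofBijective
    (fun a : S.permCon.Quotient =>
      AddCon.liftOn a (fun a => (⟨S.permOf a, S.permOf_mem a⟩ : S.permutationGroup))
        fun _ _ h => Subtype.ext h)
    ⟨fun a b h => by
      induction a using AddCon.induction_on with | H a => ?_
      induction b using AddCon.induction_on with | H b => ?_
      exact S.coe_eq_iff.2 (congrArg Subtype.val h),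
     fun g => by
      obtain ⟨a, ha⟩ := S.exists_permOf_eq g.2
      exact ⟨a, Subtype.ext ha⟩⟩).symm

theorem cocycle_permOf (a : Multiset X) : S.cocycle ⟨S.permOf a, S.permOf_mem a⟩ = a :=
  S.cocycle.symm.injective ((S.cocycle.symm_apply_apply _).trans rfl)

theorem cocycle_mul (g h : S.permutationGroup) :
    S.cocycle (g * h) = S.cocycle g + g • S.cocycle h := by
  obtain ⟨g, hg⟩ := g
  obtain ⟨h, hh⟩ := h
  obtain ⟨a, rfl⟩ := S.exists_permOf_eq hg
  obtain ⟨b, rfl⟩ := S.exists_permOf_eq hh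
  rw [cocycle_permOf, cocycle_permOf, smul_coe, ← AddCon.coe_add, ← cocycle_permOf]
  exact congrArg _ (Subtype.ext (S.permOf_mul a b))

/-- Two distinct points have the same permutation: an element of the permutation group acting
trivially on the permutation brace satisfies `σ_{g x} = σ_x` for all `x`. -/
theorem not_injective_sigma [Nontrivial X] [IsZGroup S.permutationGroup] :
    ¬ Function.Injective S.sigma := by
  intro hinj
  have : Nontrivial S.permutationGroup := by
    obtain ⟨x, y, hxy⟩ := exists_pair_ne X
    exact ⟨⟨_, S.sigma_mem x⟩, ⟨_, S.sigma_mem y⟩, fun h => hxy (hinj (congrArg Subtype.val h))⟩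
  obtain ⟨g, hg, h⟩ := exists_ne_one_smul_eq S.cocycle S.cocycle_mul
  apply hg
  ext x
  apply hinj
  rw [← permOf_singleton, ← permOf_singleton, ← coe_eq_iff]
  exact h (({x} : Multiset X) : S.permCon.Quotient)

/-! ### Retractability and the multipermutation property -/

theorem isZGroup_ret [IsZGroup S.permutationGroup] : IsZGroup S.ret.permutationGroup := by
  have : IsZGroup S.quotientHom.range :=
    IsZGroup.of_surjective S.quotientHom.rangeRestrict_surjective
  exact IsZGroup.of_injective (Subgroup.inclusion_injective S.permutationGroup_ret_le)

theorem isMultipermutation_of_isZGroup [Nonempty X] [IsZGroup S.permutationGroup] :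
    S.IsMultipermutation := by
  induction hn : Nat.card X using Nat.strong_induction_on generalizing X with | h n ih
  have : Nonempty (Quotient S.retractSetoid) := ⟨Quotient.mk _ (Classical.arbitrary X)⟩
  rcases subsingleton_or_nontrivial X with hX | hX
  · refine ⟨1, le_rfl, ?_⟩
    change Nat.card (Quotient S.retractSetoid) = 1
    have : Subsingleton (Quotient S.retractSetoid) := inferInstance
    exact Nat.card_eq_one_iff_unique.2 ⟨‹_›, ‹_›⟩
  · have hlt : Nat.card (Quotient S.retractSetoid) < n := by
      rw [← hn]
      refine lt_of_le_of_ne (Nat.card_le_card_of_surjective _ Quotient.mk_surjective) fun h => ?_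
      have h := (Function.Surjective.bijective_of_nat_card_le
        (Quotient.mk_surjective (s := S.retractSetoid)) h.ge).injective
      exact S.not_injective_sigma fun x y hxy => h (Quotient.sound hxy)
    have := S.isZGroup_ret
    obtain ⟨k, _, hk⟩ := ih _ hlt S.ret rfl
    exact ⟨k + 1, Nat.le_add_left 1 k, by rwa [retIter_succ]⟩

end InvolutiveSolution

end YangBaxter

theorem theorem2p5 {X : Type*} [Finite X] [Nonempty X]
    (S : YangBaxter.InvolutiveSolution X)
    (hS : ∀ p : ℕ, p.Prime → ∀ P : Sylow p S.permutationGroup, IsCyclic P) :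
    S.IsMultipermutation := by
  have : IsZGroup S.permutationGroup := ⟨hS⟩
  exact S.isMultipermutation_of_isZGroup
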